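/- **Theorem 1.** Consider a finite game: finitely many players, player $j$ having a finite non-empty set $S_j$ of pure strategies, and let $i$ be a player with payoff function $u_i : \prod_j S_j \to [-1,1]$. The game is played repeatedly at times $t = 1, 2, \dots$; $s_t = (s_{t,j})_j$ denotes the profile played at time $t$ and $s_{t,-i}$ the moves of the players other than $i$. The opponents of $i$ are arbitrary and possibly adaptive: $s_{t,-i}$ may depend on everything that happened before time $t$ and on private randomness of the opponents. Player $i$ uses *sampled fictitious play with Bernoulli sampling*: at each time $t$ she draws fresh i.i.d. signs $\epsilon^{(t)}_1, \dots, \epsilon^{(t)}_{t-1}$ with $P(\epsilon^{(t)}_\tau = +1) = P(\epsilon^{(t)}_\tau = -1) = \tfrac12$, independent of everything that happened before time $t$, of the private randomness of the opponents and of $s_{t,-i}$; she puts $\mathbb{S}_t = \{\tau \in \{1,\dots,t-1\} : \epsilon^{(t)}_\tau = +1\}$ and plays $$ s_{t,i} \in \arg\max_{k \in S_i} \sum_{\tau \in \mathbb{S}_t} u_i(k, s_{\tau,-i}), $$ ties being broken uniformly at random and independently of all previous randomness (including that of the opponents, and of $s_{t,-i}$); if $\mathbb{S}_t = \emptyset$,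 the argmax is all of $S_i$. Let $$ \mathcal{R}_T = \max_{k \in S_i} \sum_{t=1}^T u_i(k, s_{t,-i}) - \sum_{t=1}^T u_i(s_t) $$ be the regret of player $i$. Then player $i$'s procedure is Hannan consistent: $$ \limsup_{T \to \infty} \frac{\mathcal{R}_T}{T} \le 0 \quad \text{almost surely.} $$ -/

import Mathlib

open MeasureTheory ProbabilityTheory Filter

namespace RepeatedGame

/-- `cumPayoff v i s A k = ∑ τ ∈ A, v (k, s_{τ,-i})`: the total payoff that player `i`, whose payoff
function is `v`, would have got over the rounds in `A` by playing `k` in each of them, the moves of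
the other players being those of the sequence of plays `s`. -/
def cumPayoff {ι : Type*} [DecidableEq ι] {S : ι → Type*} (v : (∀ j, S j) → ℝ) (i : ι)
    (s : ℕ → ∀ j, S j) (A : Finset ℕ) (k : S i) : ℝ :=
  ∑ τ ∈ A, v (Function.update (s τ) i k)

/-- Regret of player `i` after `T` rounds. Rounds are numbered `0, 1, 2, …`, so the first `T` rounds
are those in `Finset.range T`. -/
noncomputable def regret {ι : Type*} [DecidableEq ι] {S : ι → Type*} (v : (∀ j, S j) → ℝ) (i : ι)
    [Fintype (S i)] [Nonempty (S i)] (s : ℕ → ∀ j, S j) (T : ℕ) : ℝ :=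
  (Finset.univ.sup' Finset.univ_nonempty fun k : S i => cumPayoff v i s (Finset.range T) k)
    - ∑ τ ∈ Finset.range T, v (s τ)

open Classical in
/-- The set `argmax_k ∑ τ ∈ A, v (k, s_{τ,-i})` of best responses to the moves of the other players
in the rounds in `A` (all of `S i` if `A` is empty). -/
noncomputable def bestResponses {ι : Type*} [DecidableEq ι] {S : ι → Type*} (v : (∀ j, S j) → ℝ)
    (i : ι) [Fintype (S i)] (s : ℕ → ∀ j, S j) (A : Finset ℕ) : Finset (S i) :=
  {k | ∀ k' : S i, cumPayoff v i s A k' ≤ cumPayoff v i s A k}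

/-- The sampled set of past rounds `{τ < t | e τ = +1}` given by the signs `e`. -/
def sampledSet (t : ℕ) (e : ℕ → ℤ) : Finset ℕ :=
  {τ ∈ Finset.range t | e τ = 1}

/-- The σ-algebra generated by the signs `ε t τ`, `τ < t`, drawn in round `t`. -/
abbrev signAlgebra {Ω : Type*} (ε : ℕ → ℕ → Ω → ℤ) (t : ℕ) : MeasurableSpace Ω :=
  ⨆ τ : Fin t, MeasurableSpace.comap (ε t τ) inferInstance

/-- `s` is a random sequence of plays in which the opponents of player `i` are arbitrary, possibly
randomized and adaptive. The σ-algebra `ℱ t` is the information available to the opponents when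
they move in round `t`: it contains all plays of the rounds before `t`, and it may contain
anything else, such as the private randomness of the opponents (of all rounds). The moves of the
opponents in round `t` are any functions of that information. (All moves lie in finite sets, so
measurability is stated on points.) -/
structure IsAdaptivePlay {ι : Type*} {S : ι → Type*} {Ω : Type*} {mΩ : MeasurableSpace Ω} (i : ι)
    (ℱ : Filtration ℕ mΩ) (s : ℕ → Ω → ∀ j, S j) : Prop where
  past : ∀ t, ∀ τ < t, ∀ a : ∀ j, S j, MeasurableSet[ℱ t] {ω | s τ ω = a}
  opponents : ∀ t, ∀ j ≠ i, ∀ a : S j, MeasurableSet[ℱ t] {ω | s t ω j = a}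

/-- In the play `s`, player `i` with payoff function `v` uses sampled fictitious play with
Bernoulli sampling, the signs `ε t τ`, `τ < t`, being drawn afresh in round `t`. -/
structure IsSampledFictitiousPlay {ι : Type*} [DecidableEq ι] {S : ι → Type*} {Ω : Type*}
    {mΩ : MeasurableSpace Ω} (P : Measure Ω) (v : (∀ j, S j) → ℝ) (i : ι) [Fintype (S i)]
    (ℱ : Filtration ℕ mΩ) (ε : ℕ → ℕ → Ω → ℤ) (s : ℕ → Ω → ∀ j, S j) : Prop where
  /-- The signs of round `t` are random variables ... -/
  measurable_sign : ∀ t, ∀ τ < t, Measurable (ε t τ)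
  /-- ... with the symmetric distribution on `{-1, +1}` ... -/
  sign_law : ∀ t, ∀ τ < t, P {ω | ε t τ ω = 1} = 1 / 2 ∧ P {ω | ε t τ ω = -1} = 1 / 2
  /-- ... which are mutually independent ... -/
  sign_indep : ∀ t, iIndepFun (fun τ : Fin t => ε t τ) P
  /-- ... and independent of everything that happened before, of the private randomness of the
  opponents and of their moves in round `t`. -/
  sign_fresh : ∀ t, Indep (signAlgebra ε t) (ℱ t) P
  /-- The signs of the earlier rounds belong to what happened before. -/
  sign_past : ∀ t, ∀ r < t, signAlgebra ε r ≤ ℱ t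
  /-- In round `t` player `i` plays a best response to the moves of the others in the sampled
  rounds, ties being broken uniformly at random and independently of all previous randomness:
  given `ℱ t` and the signs of round `t`, her move is uniform on the set of best responses. -/
  best_response : ∀ t, ∀ k : S i,
    P⟦{ω | s t ω i = k} | ℱ t ⊔ signAlgebra ε t⟧ =ᵐ[P] fun ω =>
      Set.indicator
        (bestResponses v i (fun τ => s τ ω) (sampledSet t fun τ => ε t τ ω) : Set (S i))
        (fun _ =>
          1 / ((bestResponses v i (fun τ => s τ ω) (sampledSet t fun τ => ε t τ ω)).card : ℝ)) k

/-- In the play `s`, player `i` with payoff function `v` almost surely has no regret in the limit. -/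
def HasNoRegret {ι : Type*} [DecidableEq ι] {S : ι → Type*} {Ω : Type*} {mΩ : MeasurableSpace Ω}
    (P : Measure Ω) (v : (∀ j, S j) → ℝ) (i : ι) [Fintype (S i)] [Nonempty (S i)]
    (s : ℕ → Ω → ∀ j, S j) : Prop :=
  ∀ᵐ ω ∂P, limsup (fun T : ℕ => regret v i (fun τ => s τ ω) T / (T : ℝ)) atTop ≤ 0

end RepeatedGame

/-! The expected maximum of the cumulative payoffs over a uniformly random subset of the past
rounds, doubled, serves as a potential. It dominates the maximum over all past rounds, and in round
`t` it grows by the expected payoff of sampled fictitious play in that round, up to an error: a loss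
occurs only if adding round `t` changes the order of two alternatives `k`, `l` in the sample. This
requires the sampled sum of the payoff differences of `k` and `l` to be at most as large as the
difference in round `t`. By the Littlewood–Offord theorem, which Erdős deduced from Sperner's
theorem, such an event is unlikely once many rounds with a difference of at least `η` have passed,
whereas rounds with smaller differences lose at most `η`. Hence the total error is `o(T)`, uniformly
in the moves of the opponents. Finally, the strong law of large numbers for bounded martingale
differences replaces the conditionally expected payoffs by the realized ones. -/

namespace RepeatedGame

open scoped BigOperators symmDiff Topology

section LittlewoodOfford

theorem mul_centralBinom_sq_le (n : ℕ) : (2 * n + 1) * n.centralBinom ^ 2 ≤ 16 ^ n := by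
  induction n with
  | zero => simp
  | succ n ih =>
    refine le_of_mul_le_mul_left ?_ (show 0 < (n + 1) ^ 2 by positivity)
    calc (n + 1) ^ 2 * ((2 * (n + 1) + 1) * (n + 1).centralBinom ^ 2)
        = (2 * n + 3) * ((n + 1) * (n + 1).centralBinom) ^ 2 := by ring
      _ = 4 * ((2 * n + 3) * (2 * n + 1)) * ((2 * n + 1) * n.centralBinom ^ 2) := by
        rw [Nat.succ_mul_centralBinom_succ]; ring
      _ ≤ 16 * (n + 1) ^ 2 * 16 ^ n := Nat.mul_le_mul (by nlinarith) ih
      _ = (n + 1) ^ 2 * 16 ^ (n + 1) := by ring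

theorem tendsto_centralBinom_div_four_pow :
    Tendsto (fun n : ℕ => (n.centralBinom : ℝ) / 4 ^ n) atTop (𝓝 0) := by
  have hsqrt : Tendsto (fun n : ℕ => √(1 / ((n : ℝ) + 1))) atTop (𝓝 0) := by
    simpa using (tendsto_one_div_add_atTop_nhds_zero_nat (𝕜 := ℝ)).sqrt
  refine squeeze_zero (fun n => by positivity) (fun n => Real.le_sqrt_of_sq_le ?_) hsqrt
  have h : ((2 * n + 1) * n.centralBinom ^ 2 : ℝ) ≤ 16 ^ n := mod_cast mul_centralBinom_sq_le n
  rw [div_pow, ← pow_mul, mul_comm n 2, pow_mul, div_le_div_iff₀ (by positivity) (by positivity)]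
  norm_num
  nlinarith [mul_nonneg n.cast_nonneg (sq_nonneg (n.centralBinom : ℝ))]

theorem choose_half_div_two_pow (n : ℕ) :
    (n.choose (n / 2) : ℝ) / 2 ^ n = ((n + 1) / 2).centralBinom / 4 ^ ((n + 1) / 2) := by
  obtain ⟨m, rfl | rfl⟩ := n.even_or_odd'
  · rw [Nat.mul_div_cancel_left m two_pos, show (2 * m + 1) / 2 = m by lia,
      Nat.centralBinom_eq_two_mul_choose, pow_mul]
    norm_num
  · have h : (m + 1).centralBinom = 2 * (2 * m + 1).choose m := by
      rw [Nat.centralBinom_eq_two_mul_choose, mul_add_one, Nat.choose_succ_succ',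
        Nat.choose_symm_half, ← two_mul]
    rw [show (2 * m + 1) / 2 = m by lia, show (2 * m + 1 + 1) / 2 = m + 1 by lia, h,
      show (4 : ℝ) = 2 ^ 2 by norm_num, ← pow_mul, mul_add_one, pow_succ _ (2 * m + 1)]
    push_cast
    field_simp

theorem tendsto_choose_half_div_two_pow :
    Tendsto (fun n : ℕ => (n.choose (n / 2) : ℝ) / 2 ^ n) atTop (𝓝 0) := by
  simp only [choose_half_div_two_pow]
  exact tendsto_centralBinom_div_four_pow.comp
    ((Nat.tendsto_div_const_atTop two_ne_zero).comp (tendsto_add_atTop_nat 1))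

variable {α : Type*} {I B : Finset α} {d : α → ℝ} {η : ℝ}

theorem card_le_choose_half_of_isAntichain {𝒜 : Finset (Finset α)}
    (h𝒜 : IsAntichain (· ⊆ ·) (𝒜 : Set (Finset α))) (hI : ∀ A ∈ 𝒜, A ⊆ I) :
    𝒜.card ≤ I.card.choose (I.card / 2) := by
  classical
  have hmap {A : Finset α} (hA : A ∈ 𝒜) : (A.subtype (· ∈ I)).map (.subtype _) = A :=
    Finset.subtype_map_of_mem fun a ha => hI A hA ha
  have hinj : Set.InjOn (Finset.subtype (· ∈ I)) (𝒜 : Set (Finset α)) := fun A hA A' hA' h => by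
    rw [← hmap hA, ← hmap hA', h]
  have hanti : IsAntichain (· ⊆ ·) (𝒜.image (Finset.subtype (· ∈ I)) : Set (Finset I)) := by
    rw [Finset.coe_image]
    rintro _ ⟨A, hA, rfl⟩ _ ⟨A', hA', rfl⟩ hne hsub
    refine h𝒜 hA hA' (fun h => hne (by rw [h])) ?_
    rw [← hmap hA, ← hmap hA']
    exact Finset.map_subset_map.2 hsub
  simpa [Finset.card_image_of_injOn hinj] using hanti.sperner

theorem isAntichain_setOf_sum_mem_Ico (hd : ∀ a ∈ I, η ≤ d a) (h0 : ∀ a ∈ I, 0 ≤ d a) (x : ℝ) :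
    IsAntichain (· ⊆ ·) {A : Finset α | A ⊆ I ∧ ∑ a ∈ A, d a ∈ Set.Ico x (x + η)} := by
  classical
  rintro A ⟨-, hA⟩ A' ⟨hA'I, hA'⟩ hne hsub
  obtain ⟨b, hb, hbA⟩ := Finset.exists_of_ssubset (hsub.ssubset_of_ne hne)
  have hle : ∑ a ∈ insert b A, d a ≤ ∑ a ∈ A', d a :=
    Finset.sum_le_sum_of_subset_of_nonneg (Finset.insert_subset hb hsub)
      fun a ha _ => h0 a (hA'I ha)
  rw [Finset.sum_insert hbA] at hle
  linarith [hd b (hA'I hb), hA.1, hA'.2]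

theorem sum_symmDiff_filter_neg [DecidableEq α] {A : Finset α} (hA : A ⊆ I) :
    ∑ a ∈ A ∆ {a ∈ I | d a < 0}, |d a| = ∑ a ∈ A, d a + ∑ a ∈ I with d a < 0, |d a| := by
  have hsum {C : Finset α} (hC : C ⊆ I) (f : α → ℝ) :
      ∑ a ∈ C, f a = ∑ a ∈ I, if a ∈ C then f a else 0 := by
    rw [Finset.sum_ite_mem, Finset.inter_eq_right.2 hC]
  have hneg : {a ∈ I | d a < 0} ⊆ I := Finset.filter_subset _ _
  have hsymm : A ∆ {a ∈ I | d a < 0} ⊆ I :=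
    symmDiff_le_sup.trans (Finset.union_subset hA hneg)
  rw [hsum hsymm, hsum hA, hsum hneg, ← Finset.sum_add_distrib]
  refine Finset.sum_congr rfl fun a ha => ?_
  by_cases haA : a ∈ A <;> by_cases hda : d a < 0 <;>
    simp [Finset.mem_symmDiff, ha, haA, hda, abs_of_neg, abs_of_nonneg, not_lt.1]

/- Erdős: exchanging membership of the indices with `d a < 0` turns the sums into sums of `|d a|`,
up to a shift, and for these the subsets in question form an antichain. -/
theorem card_powerset_filter_sum_mem_Ico_le (hd : ∀ a ∈ I, η ≤ |d a|) (x : ℝ) :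
    {A ∈ I.powerset | ∑ a ∈ A, d a ∈ Set.Ico x (x + η)}.card ≤ I.card.choose (I.card / 2) := by
  classical
  set N : Finset α := {a ∈ I | d a < 0}
  set y := x + ∑ a ∈ N, |d a|
  have hanti := (isAntichain_setOf_sum_mem_Ico hd (fun a _ => abs_nonneg (d a)) y)
  calc _ ≤ {A ∈ I.powerset | ∑ a ∈ A, |d a| ∈ Set.Ico y (y + η)}.card := by
        refine Finset.card_le_card_of_injOn (· ∆ N) (fun A hA => ?_)
          (symmDiff_left_injective N).injOn
        simp only [Finset.coe_filter, Finset.mem_powerset, Set.mem_ofPred_eq, Set.mem_Ico] at hA ⊢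
        refine ⟨symmDiff_le_sup.trans (Finset.union_subset hA.1 (Finset.filter_subset _ _)), ?_⟩
        rw [sum_symmDiff_filter_neg hA.1]
        constructor <;> linarith
    _ ≤ _ := card_le_choose_half_of_isAntichain (by simpa using hanti) (by simp +contextual)

theorem expect_powerset_insert [DecidableEq α] {b : α} (hb : b ∉ B) (f : Finset α → ℝ) :
    𝔼 A ∈ (insert b B).powerset, f A
      = (𝔼 A ∈ B.powerset, f A + 𝔼 A ∈ B.powerset, f (insert b A)) / 2 := by
  simp only [Finset.expect_eq_sum_div_card, Finset.card_powerset, Finset.sum_powerset_insert hb,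
    Finset.card_insert_of_notMem hb]
  push_cast
  field_simp
  ring

/- Induction on the part of `B` outside `I`: a new index only shifts the interval. -/
theorem expect_powerset_sum_mem_Ico_le (hd : ∀ a ∈ I, η ≤ |d a|) (hI : I ⊆ B) (x : ℝ) :
    𝔼 A ∈ B.powerset, (if ∑ a ∈ A, d a ∈ Set.Ico x (x + η) then 1 else 0 : ℝ)
      ≤ I.card.choose (I.card / 2) / 2 ^ I.card := by
  classical
  obtain ⟨C, hC, rfl⟩ : ∃ C, Disjoint C I ∧ C ∪ I = B :=
    ⟨B \ I, Finset.sdiff_disjoint, Finset.sdiff_union_of_subset hI⟩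
  clear hI
  induction C using Finset.induction_on generalizing x with
  | empty =>
    simp only [Finset.empty_union, Finset.expect_eq_sum_div_card, Finset.sum_boole,
      Finset.card_powerset, Nat.cast_pow, Nat.cast_ofNat]
    gcongr
    exact card_powerset_filter_sum_mem_Ico_le hd x
  | insert b C _ ih =>
    obtain ⟨hbI, hC⟩ := Finset.disjoint_insert_left.1 hC
    have hb : b ∉ C ∪ I := by simp_all
    have hshift : ∀ A ∈ (C ∪ I).powerset,
        (if ∑ a ∈ insert b A, d a ∈ Set.Ico x (x + η) then 1 else 0 : ℝ)
          = if ∑ a ∈ A, d a ∈ Set.Ico (x - d b) (x - d b + η) then 1 else 0 := fun A hA => by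
      rw [Finset.sum_insert fun h => hb (Finset.mem_powerset.1 hA h)]
      simp only [Set.mem_Ico, sub_le_iff_le_add', sub_add_eq_add_sub, lt_sub_iff_add_lt']
    rw [Finset.insert_union, expect_powerset_insert hb, Finset.expect_congr rfl hshift]
    linarith [ih x hC, ih (x - d b) hC]

/- The interval `[-c, c]` is covered by `⌊2c/η⌋ + 1` intervals of length `η`. -/
theorem expect_powerset_abs_sum_le (hη : 0 < η) (hd : ∀ a ∈ I, η ≤ |d a|) (hI : I ⊆ B) (c : ℝ) :
    𝔼 A ∈ B.powerset, (if |∑ a ∈ A, d a| ≤ c then 1 else 0 : ℝ)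
      ≤ (⌊2 * c / η⌋₊ + 1) * (I.card.choose (I.card / 2) / 2 ^ I.card) := by
  have hcover (y : ℝ) : (if |y| ≤ c then 1 else 0 : ℝ) ≤ ∑ j ∈ Finset.range (⌊2 * c / η⌋₊ + 1),
      if y ∈ Set.Ico (-c + j * η) (-c + j * η + η) then 1 else 0 := by
    split_ifs with hy
    · obtain ⟨hy₁, hy₂⟩ := abs_le.1 hy
      have hj : ⌊(y + c) / η⌋₊ ∈ Finset.range (⌊2 * c / η⌋₊ + 1) :=
        Finset.mem_range_succ_iff.2 (Nat.floor_le_floor (by gcongr; linarith))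
      refine le_trans ?_ (Finset.single_le_sum (fun j _ => by positivity) hj)
      have hle := Nat.floor_le (div_nonneg (neg_le_iff_add_nonneg.1 hy₁) hη.le)
      have hlt := Nat.lt_floor_add_one ((y + c) / η)
      rw [le_div_iff₀ hη] at hle
      rw [div_lt_iff₀ hη] at hlt
      rw [if_pos ⟨by linarith, by linarith⟩]
    · positivity
  calc _ ≤ _ := Finset.expect_le_expect fun A _ => hcover (∑ a ∈ A, d a)
    _ = ∑ j ∈ Finset.range (⌊2 * c / η⌋₊ + 1), 𝔼 A ∈ B.powerset,
        (if ∑ a ∈ A, d a ∈ Set.Ico (-c + j * η) (-c + j * η + η) then 1 else 0 : ℝ) :=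
      Finset.expect_sum_comm ..
    _ ≤ ∑ _j ∈ Finset.range (⌊2 * c / η⌋₊ + 1),
        (I.card.choose (I.card / 2) : ℝ) / 2 ^ I.card :=
      Finset.sum_le_sum fun j _ => expect_powerset_sum_mem_Ico_le hd hI (-c + j * η)
    _ = _ := by simp

end LittlewoodOfford

section Pivotal

variable {d : ℕ → ℝ} {c η : ℝ}

/-- The probability that the sum of `d` over a uniformly random subset of the indices before `t` is
at most `|d t|` in absolute value, so that adding or omitting `d t` may decide the sign of the sum.
For `d` the difference of the payoffs of two alternatives, it bounds the probability that round `t`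
changes their order in the sampled cumulative payoffs. -/
noncomputable def pivotalProb (d : ℕ → ℝ) (t : ℕ) : ℝ :=
  𝔼 A ∈ (Finset.range t).powerset, if |∑ τ ∈ A, d τ| ≤ |d t| then 1 else 0

theorem pivotalProb_le_one (d : ℕ → ℝ) (t : ℕ) : pivotalProb d t ≤ 1 :=
  Finset.expect_le (Finset.powerset_nonempty _) fun _ _ => by split_ifs <;> norm_num

theorem pivotalProb_nonneg (d : ℕ → ℝ) (t : ℕ) : 0 ≤ pivotalProb d t :=
  Finset.expect_nonneg fun _ _ => by positivity

theorem pivotalProb_le (hη : 0 < η) {t : ℕ} (hd : |d t| ≤ c) :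
    pivotalProb d t ≤ (⌊2 * c / η⌋₊ + 1) *
      ((Nat.count (η ≤ |d ·|) t).choose (Nat.count (η ≤ |d ·|) t / 2)
        / 2 ^ Nat.count (η ≤ |d ·|) t) := by
  rw [Nat.count_eq_card_filter_range]
  refine le_trans (Finset.expect_le_expect fun A _ => ?_) (expect_powerset_abs_sum_le (c := c) hη
    (fun a ha => (Finset.mem_filter.1 ha).2) (Finset.filter_subset _ _))
  split_ifs with h₁ h₂
  exacts [le_rfl, absurd (h₁.trans hd) h₂, zero_le_one, le_rfl]

theorem sum_range_ite_count (p : ℕ → Prop) [DecidablePred p] {M : Type*} [AddCommMonoid M]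
    (b : ℕ → M) (T : ℕ) :
    ∑ t ∈ Finset.range T, (if p t then b (Nat.count p t) else 0)
      = ∑ n ∈ Finset.range (Nat.count p T), b n := by
  induction T with
  | zero => simp
  | succ T ih =>
    rw [Finset.sum_range_succ, ih, Nat.count_succ]
    split_ifs
    · rw [Finset.sum_range_succ]
    · simp

/- A round with `|d t| < η` contributes at most `η`; the other rounds contribute, in their order,
at most a constant times the successive Littlewood–Offord bounds. -/
theorem sum_abs_mul_pivotalProb_le (hη : 0 < η) (hd : ∀ t, |d t| ≤ c) (T : ℕ) :
    ∑ t ∈ Finset.range T, |d t| * pivotalProb d t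
      ≤ η * T + ∑ n ∈ Finset.range T, c * ((⌊2 * c / η⌋₊ + 1) * (n.choose (n / 2) / 2 ^ n)) := by
  have hc : 0 ≤ c := (abs_nonneg _).trans (hd 0)
  set b : ℕ → ℝ := fun n => c * ((⌊2 * c / η⌋₊ + 1) * (n.choose (n / 2) / 2 ^ n))
  have hround (t : ℕ) : |d t| * pivotalProb d t
      ≤ η + if η ≤ |d t| then b (Nat.count (η ≤ |d ·|) t) else 0 := by
    split_ifs with h
    · have := mul_le_mul (hd t) (pivotalProb_le hη (hd t)) (pivotalProb_nonneg d t) hc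
      linarith
    · have := mul_le_of_le_one_right (abs_nonneg (d t)) (pivotalProb_le_one d t)
      linarith [not_le.1 h]
  calc _ ≤ _ := Finset.sum_le_sum fun t _ => hround t
    _ = η * T + ∑ n ∈ Finset.range (Nat.count (η ≤ |d ·|) T), b n := by
      rw [Finset.sum_add_distrib, sum_range_ite_count]
      simp [mul_comm]
    _ ≤ η * T + ∑ n ∈ Finset.range T, b n := by
      gcongr
      exact Nat.count_le _

theorem eventually_forall_sum_abs_mul_pivotalProb_le (c : ℝ) {δ : ℝ} (hδ : 0 < δ) :
    ∀ᶠ T : ℕ in atTop, ∀ d : ℕ → ℝ, (∀ t, |d t| ≤ c) →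
      ∑ t ∈ Finset.range T, |d t| * pivotalProb d t ≤ δ * T := by
  have hlim : Tendsto (fun n : ℕ => c * ((⌊2 * c / (δ / 2)⌋₊ + 1 : ℝ) *
      (n.choose (n / 2) / 2 ^ n))) atTop (𝓝 0) := by
    simpa using (tendsto_choose_half_div_two_pow.const_mul (⌊2 * c / (δ / 2)⌋₊ + 1 : ℝ)).const_mul c
  filter_upwards [hlim.cesaro.eventually_lt_const (half_pos hδ), eventually_gt_atTop 0]
    with T hT hT0 d hd
  rw [inv_mul_lt_iff₀ (by positivity)] at hT
  linarith [sum_abs_mul_pivotalProb_le (half_pos hδ) hd T]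

end Pivotal

section SampledPayoff

open Classical in
/-- The set of maximizers of `X`, from which sampled fictitious play picks uniformly at random. -/
noncomputable def argmaxes {K : Type*} [Fintype K] (X : K → ℝ) : Finset K :=
  {k | ∀ k', X k' ≤ X k}

/-- The expected payoff in round `t` of sampled fictitious play when `g τ k` is the payoff of the
alternative `k` in round `τ`: the average over the sampled sets of rounds `A`, all equally likely,
and over the maximizers of the cumulative payoff in `A`. -/
noncomputable def sampledPayoff {K : Type*} [Fintype K] (g : ℕ → K → ℝ) (t : ℕ) : ℝ :=
  𝔼 A ∈ (Finset.range t).powerset, 𝔼 k ∈ argmaxes (fun k => ∑ τ ∈ A, g τ k), g t k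

variable {K : Type*} [Fintype K]

theorem mem_argmaxes {X : K → ℝ} {k : K} : k ∈ argmaxes X ↔ ∀ k', X k' ≤ X k := by
  simp [argmaxes]

variable [Nonempty K] {g : ℕ → K → ℝ} {c : ℝ}

theorem argmaxes_nonempty (X : K → ℝ) : (argmaxes X).Nonempty :=
  (Finite.exists_max X).imp fun _ hk => mem_argmaxes.2 hk

theorem abs_expect_le_of_forall_abs_le {α : Type*} {s : Finset α} (hs : s.Nonempty) {f : α → ℝ}
    (hf : ∀ a ∈ s, |f a| ≤ c) : |𝔼 a ∈ s, f a| ≤ c :=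
  (Finset.abs_expect_le s f).trans (Finset.expect_le hs hf)

theorem abs_sampledPayoff_le {t : ℕ} (hg : ∀ k, |g t k| ≤ c) : |sampledPayoff g t| ≤ c :=
  abs_expect_le_of_forall_abs_le (Finset.powerset_nonempty _) fun _ _ =>
    abs_expect_le_of_forall_abs_le (argmaxes_nonempty _) fun k _ => hg k

/- If `k` maximizes `X` and `j` maximizes `X + g`, then `0 ≤ X k - X j ≤ g j - g k`: either `k` is
still a maximizer, or the pair `(j, k)` occurs in the sum. -/
theorem ciSup_add_le_ciSup_add_expect_argmaxes (X g : K → ℝ) :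
    (⨆ k, (X k + g k)) ≤ (⨆ k, X k) + 𝔼 k ∈ argmaxes X, g k + ∑ p : K × K,
      |g p.1 - g p.2| * if |X p.1 - X p.2| ≤ |g p.1 - g p.2| then 1 else 0 := by
  set loss : K × K → ℝ := fun p =>
    |g p.1 - g p.2| * if |X p.1 - X p.2| ≤ |g p.1 - g p.2| then 1 else 0
  suffices (⨆ k, (X k + g k)) - (⨆ k, X k) - ∑ p, loss p ≤ 𝔼 k ∈ argmaxes X, g k by linarith
  refine Finset.le_expect (argmaxes_nonempty X) fun k hk => ?_
  obtain ⟨j, hj⟩ := exists_eq_ciSup_of_finite (f := fun k => X k + g k)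
  have hX : X j - X k ≤ 0 := sub_nonpos.2 (mem_argmaxes.1 hk j)
  have hXg : X k + g k ≤ X j + g j := hj ▸ Finite.le_ciSup (fun k => X k + g k) k
  have hg : 0 ≤ g j - g k := by linarith
  have hloss : g j - g k ≤ ∑ p, loss p := by
    refine le_trans ?_
      (Finset.single_le_sum (fun p _ => by positivity) (Finset.mem_univ (j, k)))
    simp only [loss, abs_of_nonpos hX, abs_of_nonneg hg]
    rw [if_pos (by linarith), mul_one]
  linarith [Finite.le_ciSup X k]

theorem expect_powerset_sum {α : Type*} (B : Finset α) (f : α → ℝ) :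
    𝔼 A ∈ B.powerset, ∑ a ∈ A, f a = (∑ a ∈ B, f a) / 2 := by
  classical
  induction B using Finset.induction_on with
  | empty => simp
  | insert b B hb ih =>
    have hinsert : ∀ A ∈ B.powerset, ∑ a ∈ insert b A, f a = f b + ∑ a ∈ A, f a :=
      fun A hA => Finset.sum_insert fun h => hb (Finset.mem_powerset.1 hA h)
    rw [expect_powerset_insert hb, Finset.expect_congr rfl hinsert, Finset.expect_add_distrib,
      Finset.expect_const (Finset.powerset_nonempty _), Finset.sum_insert hb, ih]
    ring

theorem ciSup_sum_le_two_mul_expect_powerset {α K : Type*} [Finite K] [Nonempty K] (B : Finset α)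
    (g : α → K → ℝ) : (⨆ k, ∑ a ∈ B, g a k) ≤ 2 * 𝔼 A ∈ B.powerset, ⨆ k, ∑ a ∈ A, g a k := by
  refine ciSup_le fun k => ?_
  have hle : 𝔼 A ∈ B.powerset, ∑ a ∈ A, g a k ≤ 𝔼 A ∈ B.powerset, ⨆ k, ∑ a ∈ A, g a k :=
    Finset.expect_le_expect fun A _ => Finite.le_ciSup (fun k => ∑ a ∈ A, g a k) k
  rw [expect_powerset_sum] at hle
  linarith

/- The left-hand side is the potential: in round `T`, the sampled set contains `T` with
probability `1 / 2`, so that the increment of the potential is the expected increase of the maximum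
under the addition of `g T`. -/
theorem two_mul_expect_powerset_ciSup_sum_le (g : ℕ → K → ℝ) (T : ℕ) :
    2 * 𝔼 A ∈ (Finset.range T).powerset, ⨆ k, ∑ τ ∈ A, g τ k
      ≤ ∑ t ∈ Finset.range T, sampledPayoff g t + ∑ p : K × K, ∑ t ∈ Finset.range T,
        |g t p.1 - g t p.2| * pivotalProb (fun τ => g τ p.1 - g τ p.2) t := by
  induction T with
  | zero => simp
  | succ T ih =>
    have hstep : 𝔼 A ∈ (Finset.range T).powerset, ⨆ k, ∑ τ ∈ insert T A, g τ k
        ≤ 𝔼 A ∈ (Finset.range T).powerset, (⨆ k, ∑ τ ∈ A, g τ k) + sampledPayoff g T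
          + ∑ p : K × K,
            |g T p.1 - g T p.2| * pivotalProb (fun τ => g τ p.1 - g τ p.2) T := by
      simp only [sampledPayoff, pivotalProb, Finset.mul_expect, ← Finset.expect_add_distrib,
        ← Finset.expect_sum_comm]
      refine Finset.expect_le_expect fun A hA => ?_
      have hT : T ∉ A := fun h => by simpa using Finset.mem_powerset.1 hA h
      simp only [Finset.sum_insert hT, add_comm (g T _), Finset.sum_sub_distrib]
      exact ciSup_add_le_ciSup_add_expect_argmaxes _ _
    simp only [Finset.sum_range_succ, Finset.sum_add_distrib]
    rw [Finset.range_add_one, expect_powerset_insert Finset.notMem_range_self]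
    linarith

theorem eventually_forall_ciSup_sum_le_sum_sampledPayoff_add (K : Type*) [Fintype K] [Nonempty K]
    (c : ℝ) {δ : ℝ} (hδ : 0 < δ) :
    ∀ᶠ T : ℕ in atTop, ∀ g : ℕ → K → ℝ, (∀ t k, |g t k| ≤ c) →
      (⨆ k, ∑ t ∈ Finset.range T, g t k) ≤ ∑ t ∈ Finset.range T, sampledPayoff g t + δ * T := by
  have hδ' : 0 < δ / Fintype.card (K × K) := by positivity
  filter_upwards [eventually_forall_sum_abs_mul_pivotalProb_le (2 * c) hδ'] with T hT g hg
  have hpair (p : K × K) (t : ℕ) : |g t p.1 - g t p.2| ≤ 2 * c :=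
    (abs_sub _ _).trans (by linarith [hg t p.1, hg t p.2])
  calc _ ≤ _ := ciSup_sum_le_two_mul_expect_powerset (Finset.range T) g
    _ ≤ _ := two_mul_expect_powerset_ciSup_sum_le g T
    _ ≤ ∑ t ∈ Finset.range T, sampledPayoff g t
        + ∑ _p : K × K, δ / Fintype.card (K × K) * T := by
      gcongr with p
      exact hT _ (hpair p)
    _ = _ := by
      rw [Finset.sum_const, Finset.card_univ, nsmul_eq_mul]
      field_simp

end SampledPayoff

section MartingaleDifferences

variable {Ω : Type*} {mΩ : MeasurableSpace Ω} {P : Measure Ω} [IsFiniteMeasure P]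
  {ℱ : Filtration ℕ mΩ} {Y : ℕ → Ω → ℝ}

theorem stronglyMeasurable_sum_range (hY : ∀ t, StronglyMeasurable[ℱ (t + 1)] (Y t)) (T : ℕ) :
    StronglyMeasurable[ℱ T] fun ω => ∑ t ∈ Finset.range T, Y t ω :=
  Finset.stronglyMeasurable_fun_sum _ fun t ht =>
    (hY t).mono (ℱ.mono (Finset.mem_range.1 ht))

theorem martingale_sum_range (hY : ∀ t, StronglyMeasurable[ℱ (t + 1)] (Y t))
    (hint : ∀ t, Integrable (Y t) P) (h0 : ∀ t, P[Y t | ℱ t] =ᵐ[P] 0) :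
    Martingale (fun T ω => ∑ t ∈ Finset.range T, Y t ω) ℱ P := by
  refine martingale_of_condExp_sub_eq_zero_nat (stronglyMeasurable_sum_range hY)
    (fun T => integrable_finsetSum _ fun t _ => hint t) fun T => ?_
  convert h0 T using 2
  ext ω
  simp [Finset.sum_range_succ]

theorem integral_mul_eq_zero_of_condExp_eq_zero {m : MeasurableSpace Ω} (hm : m ≤ mΩ)
    {f g : Ω → ℝ} (hf : StronglyMeasurable[m] f) (hfg : Integrable (f * g) P)
    (hg : Integrable g P) (h0 : P[g | m] =ᵐ[P] 0) : ∫ ω, f ω * g ω ∂P = 0 := by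
  have h : P[f * g | m] =ᵐ[P] 0 := by
    filter_upwards [condExp_mul_of_stronglyMeasurable_left hf hfg hg, h0] with ω h₁ h₂
    simp [h₁, h₂]
  calc ∫ ω, (f * g) ω ∂P = ∫ ω, P[f * g | m] ω ∂P := (integral_condExp hm).symm
    _ = 0 := by simp [integral_congr_ae h]

theorem integral_sq_sum_range (hY : ∀ t, StronglyMeasurable[ℱ (t + 1)] (Y t))
    (hL2 : ∀ t, MemLp (Y t) 2 P) (h0 : ∀ t, P[Y t | ℱ t] =ᵐ[P] 0) (T : ℕ) :
    ∫ ω, (∑ t ∈ Finset.range T, Y t ω) ^ 2 ∂P = ∑ t ∈ Finset.range T, ∫ ω, Y t ω ^ 2 ∂P := by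
  induction T with
  | zero => simp
  | succ T ih =>
    have hsum : MemLp (fun ω => ∑ t ∈ Finset.range T, Y t ω) 2 P :=
      memLp_finsetSum _ fun t _ => hL2 t
    have hprod : Integrable (fun ω => (∑ t ∈ Finset.range T, Y t ω) * Y T ω) P :=
      hsum.integrable_mul (hL2 T)
    have hcross : ∫ ω, (∑ t ∈ Finset.range T, Y t ω) * Y T ω ∂P = 0 :=
      integral_mul_eq_zero_of_condExp_eq_zero (ℱ.le T) (stronglyMeasurable_sum_range hY T) hprod
        ((hL2 T).integrable one_le_two) (h0 T)
    simp only [Finset.sum_range_succ, add_sq, mul_assoc]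
    rw [integral_add (by exact hsum.integrable_sq.add (hprod.const_mul 2)) (hL2 T).integrable_sq,
      integral_add hsum.integrable_sq (hprod.const_mul 2), integral_const_mul, hcross, ih]
    simp

theorem ae_exists_tendsto_sum_range (hY : ∀ t, StronglyMeasurable[ℱ (t + 1)] (Y t))
    (hL2 : ∀ t, MemLp (Y t) 2 P) (h0 : ∀ t, P[Y t | ℱ t] =ᵐ[P] 0)
    (hsum : Summable fun t => ∫ ω, Y t ω ^ 2 ∂P) :
    ∀ᵐ ω ∂P, ∃ a, Tendsto (fun T => ∑ t ∈ Finset.range T, Y t ω) atTop (𝓝 a) := by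
  refine (martingale_sum_range hY (fun t => (hL2 t).integrable one_le_two)
    h0).submartingale.exists_ae_tendsto_of_bdd
      (R := (P.real Set.univ + ∑' t, ∫ ω, Y t ω ^ 2 ∂P).toNNReal) fun T => ?_
  have hsumL2 : MemLp (fun ω => ∑ t ∈ Finset.range T, Y t ω) 2 P :=
    memLp_finsetSum _ fun t _ => hL2 t
  have hbound : ∫ ω, ‖∑ t ∈ Finset.range T, Y t ω‖ ∂P
      ≤ P.real Set.univ + ∑' t, ∫ ω, Y t ω ^ 2 ∂P := by
    calc _ ≤ ∫ ω, (1 + (∑ t ∈ Finset.range T, Y t ω) ^ 2) ∂P := by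
          refine integral_mono (hsumL2.integrable one_le_two).norm
            ((integrable_const 1).add hsumL2.integrable_sq) fun ω => ?_
          rw [Real.norm_eq_abs, ← sq_abs (∑ t ∈ Finset.range T, Y t ω)]
          nlinarith [sq_nonneg (|∑ t ∈ Finset.range T, Y t ω| - 1)]
      _ = P.real Set.univ + ∑ t ∈ Finset.range T, ∫ ω, Y t ω ^ 2 ∂P := by
          rw [integral_add (integrable_const 1) hsumL2.integrable_sq,
            integral_sq_sum_range hY hL2 h0]
          simp
      _ ≤ _ := by
          gcongr
          exact hsum.sum_le_tsum _ fun t _ => integral_nonneg fun ω => sq_nonneg _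
  rw [eLpNorm_one_eq_lintegral_enorm,
    ← ofReal_integral_norm_eq_lintegral_enorm (hsumL2.integrable one_le_two)]
  exact ENNReal.ofReal_le_ofReal hbound

/- Kronecker's lemma: summation by parts expresses the average through the partial sums `x` of the
series and their Cesàro means, which have the same limit. -/
theorem tendsto_sum_range_div_of_tendsto_sum_range_div_succ {y : ℕ → ℝ} {a : ℝ}
    (h : Tendsto (fun n : ℕ => ∑ t ∈ Finset.range n, y t / (t + 1)) atTop (𝓝 a)) :
    Tendsto (fun n : ℕ => (∑ t ∈ Finset.range n, y t) / n) atTop (𝓝 0) := by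
  set x : ℕ → ℝ := fun n => ∑ t ∈ Finset.range n, y t / (t + 1)
  have habel (n : ℕ) : ∑ t ∈ Finset.range n, y t = n * x n - ∑ t ∈ Finset.range n, x t := by
    induction n with
    | zero => simp
    | succ n ih =>
      have hxn : x (n + 1) = x n + y n / (n + 1) := Finset.sum_range_succ ..
      rw [Finset.sum_range_succ, Finset.sum_range_succ, ih, hxn]
      push_cast
      field_simp
      ring
  refine (sub_self a ▸ h.sub h.cesaro).congr' ?_
  filter_upwards [eventually_ne_atTop 0] with n hn
  rw [habel]
  field_simp

theorem ae_tendsto_sum_range_div (hY : ∀ t, StronglyMeasurable[ℱ (t + 1)] (Y t))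
    (hL2 : ∀ t, MemLp (Y t) 2 P) (h0 : ∀ t, P[Y t | ℱ t] =ᵐ[P] 0)
    (hsum : Summable fun t : ℕ => (∫ ω, Y t ω ^ 2 ∂P) / (t + 1) ^ 2) :
    ∀ᵐ ω ∂P, Tendsto (fun n : ℕ => (∑ t ∈ Finset.range n, Y t ω) / n) atTop (𝓝 0) := by
  have hscale (t : ℕ) : (fun ω => Y t ω / (t + 1)) = (1 / (t + 1) : ℝ) • Y t := by
    ext ω
    simp [div_eq_inv_mul]
  have hconv := ae_exists_tendsto_sum_range (P := P) (ℱ := ℱ) (Y := fun t ω => Y t ω / (t + 1))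
    (fun t => hscale t ▸ (hY t).const_smul _) (fun t => hscale t ▸ (hL2 t).const_smul _)
    (fun t => ?_) (by simpa only [div_pow, integral_div] using hsum)
  · filter_upwards [hconv] with ω ⟨a, ha⟩
    exact tendsto_sum_range_div_of_tendsto_sum_range_div_succ ha
  · rw [hscale]
    filter_upwards [condExp_smul (μ := P) (1 / (t + 1) : ℝ) (Y t) (ℱ t), h0 t] with ω h₁ h₂
    rw [h₁, Pi.smul_apply, h₂, Pi.zero_apply, smul_zero]

theorem ae_tendsto_sum_range_div_of_abs_le {c : ℝ}
    (hY : ∀ t, StronglyMeasurable[ℱ (t + 1)] (Y t)) (hc : ∀ t ω, |Y t ω| ≤ c)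
    (h0 : ∀ t, P[Y t | ℱ t] =ᵐ[P] 0) :
    ∀ᵐ ω ∂P, Tendsto (fun n : ℕ => (∑ t ∈ Finset.range n, Y t ω) / n) atTop (𝓝 0) := by
  have hL2 (t : ℕ) : MemLp (Y t) 2 P :=
    .of_bound ((hY t).mono (ℱ.le _)).aestronglyMeasurable c (ae_of_all _ (hc t))
  have hsq (t : ℕ) : ∫ ω, Y t ω ^ 2 ∂P ≤ c ^ 2 * P.real Set.univ := by
    calc _ ≤ ∫ _, c ^ 2 ∂P := integral_mono (hL2 t).integrable_sq (integrable_const _) fun ω =>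
          sq_le_sq' (abs_le.1 (hc t ω)).1 (abs_le.1 (hc t ω)).2
      _ = _ := by simp [mul_comm]
  have hsum : Summable fun t : ℕ => 1 / ((t : ℝ) + 1) ^ 2 := mod_cast
    (summable_nat_add_iff 1).2 (Real.summable_one_div_nat_pow.2 one_lt_two)
  refine ae_tendsto_sum_range_div hY hL2 h0 <| .of_nonneg_of_le
    (fun t => div_nonneg (integral_nonneg fun ω => sq_nonneg _) (by positivity)) (fun t => ?_)
    (hsum.mul_left (c ^ 2 * P.real Set.univ))
  rw [mul_one_div]
  gcongr
  exact hsq t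

end MartingaleDifferences

section FiniteValued

variable {Ω : Type*} {mΩ : MeasurableSpace Ω} {P : Measure Ω}

theorem measurableSet_preimage_of_countable {α : Type*} [Countable α] {f : Ω → α}
    (hf : ∀ a, MeasurableSet {ω | f ω = a}) (A : Set α) : MeasurableSet (f ⁻¹' A) :=
  @measurable_to_countable' _ _ ⊤ _ _ _ hf A MeasurableSpace.measurableSet_top

theorem measurable_comp_of_countable {α β : Type*} [Countable α] [MeasurableSpace β] {f : Ω → α}
    (hf : ∀ a, MeasurableSet {ω | f ω = a}) (φ : α → β) : Measurable fun ω => φ (f ω) :=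
  fun U _ => measurableSet_preimage_of_countable hf (φ ⁻¹' U)

theorem measurable_expect_argmaxes {K : Type*} [Fintype K] {X g : Ω → K → ℝ}
    (hX : ∀ k, Measurable fun ω => X ω k) (hg : ∀ k, Measurable fun ω => g ω k) :
    Measurable fun ω => 𝔼 k ∈ argmaxes (X ω), g ω k := by
  classical
  have hmem (k : K) : MeasurableSet {ω | k ∈ argmaxes (X ω)} := by
    simp only [mem_argmaxes, Set.ofPred_forall]
    exact .iInter fun k' => measurableSet_le (hX k') (hX k)
  have hexpect (ω : Ω) : 𝔼 k ∈ argmaxes (X ω), g ω k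
      = (∑ k, if k ∈ argmaxes (X ω) then g ω k else 0)
        / ∑ k, if k ∈ argmaxes (X ω) then 1 else 0 := by
    simp [Finset.expect_eq_sum_div_card, Finset.sum_ite_mem]
  simp only [hexpect]
  exact (Finset.measurable_fun_sum _ fun k _ => .ite (hmem k) (hg k) measurable_const).div
    (Finset.measurable_fun_sum _ fun k _ => .ite (hmem k) measurable_const measurable_const)

theorem condExp_comp_of_mem_finset [IsFiniteMeasure P] {κ : Type*} {m : MeasurableSpace Ω}
    (hm : m ≤ mΩ) {X : Ω → κ} {B : Finset κ} (hXB : ∀ ω, X ω ∈ B)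
    (hX : ∀ a ∈ B, MeasurableSet[mΩ] {ω | X ω = a}) {F : κ → Ω → ℝ} {c : ℝ}
    (hF : ∀ a ∈ B, StronglyMeasurable[m] (F a)) (hc : ∀ a ∈ B, ∀ ω, |F a ω| ≤ c)
    {p : κ → Ω → ℝ} (hp : ∀ a ∈ B, P⟦{ω | X ω = a} | m⟧ =ᵐ[P] p a) :
    P[fun ω => F (X ω) ω | m] =ᵐ[P] fun ω => ∑ a ∈ B, F a ω * p a ω := by
  classical
  set χ : κ → Ω → ℝ := fun a => {ω | X ω = a}.indicator fun _ => 1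
  have hdecomp : (fun ω => F (X ω) ω) = ∑ a ∈ B, F a * χ a := by
    ext ω
    simp [χ, Set.indicator_apply, hXB]
  have hχ (a : κ) (ha : a ∈ B) : Integrable (χ a) P :=
    (integrable_const (1 : ℝ)).indicator (hX a ha)
  have hbound (a : κ) (ha : a ∈ B) : ∀ᵐ ω ∂P, ‖F a ω‖ ≤ c := ae_of_all _ (hc a ha)
  have hint (a : κ) (ha : a ∈ B) : Integrable (F a * χ a) P :=
    (hχ a ha).bdd_mul ((hF a ha).mono hm).aestronglyMeasurable (hbound a ha)
  have hterm : ∀ᵐ ω ∂P, ∀ a ∈ B, P[F a * χ a | m] ω = F a ω * p a ω := by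
    refine (Finset.eventually_all B).2 fun a ha => ?_
    filter_upwards [condExp_stronglyMeasurable_mul_of_bound hm (hF a ha) (hχ a ha) c
      (hbound a ha), hp a ha] with ω h₁ h₂
    rw [h₁, Pi.mul_apply, h₂]
  filter_upwards [condExp_finsetSum hint m, hterm] with ω h₁ h₂
  rw [hdecomp, h₁, Finset.sum_apply, Finset.sum_congr rfl h₂]

end FiniteValued

section SampledSet

variable {Ω : Type*} {ε : ℕ → ℕ → Ω → ℤ} {t : ℕ} {A : Finset ℕ}

theorem sampledSet_mem_powerset (t : ℕ) (e : ℕ → ℤ) :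
    sampledSet t e ∈ (Finset.range t).powerset :=
  Finset.mem_powerset.2 (Finset.filter_subset _ _)

theorem setOf_sampledSet_eq (hA : A ⊆ Finset.range t) :
    {ω | sampledSet t (fun τ => ε t τ ω) = A}
      = ⋂ τ ∈ (Finset.univ : Finset (Fin t)), ε t τ ⁻¹' {n | n = 1 ↔ (τ : ℕ) ∈ A} := by
  ext ω
  simp only [sampledSet, Set.mem_ofPred_eq, Finset.ext_iff, Finset.mem_filter, Finset.mem_range,
    Finset.mem_univ, Set.iInter_true, Set.mem_iInter, Set.mem_preimage]
  refine ⟨fun h τ => by simpa using h τ, fun h τ => ?_⟩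
  by_cases hτ : τ < t
  · simpa [hτ] using h ⟨τ, hτ⟩
  · simpa [hτ] using fun hτA => hτ (Finset.mem_range.1 (hA hτA))

theorem measurableSet_sampledSet_eq (hA : A ⊆ Finset.range t) :
    MeasurableSet[signAlgebra ε t] {ω | sampledSet t (fun τ => ε t τ ω) = A} := by
  rw [setOf_sampledSet_eq hA]
  refine Finset.measurableSet_biInter _ fun τ _ => ?_
  exact le_iSup (fun τ : Fin t => MeasurableSpace.comap (ε t τ) inferInstance) τ _
    ⟨_, .of_discrete, rfl⟩

end SampledSet

section Play

variable {ι : Type*} {S : ι → Type*} {Ω : Type*} {mΩ : MeasurableSpace Ω} {P : Measure Ω}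
  {v : (∀ j, S j) → ℝ} {i : ι} {ℱ : Filtration ℕ mΩ} {ε : ℕ → ℕ → Ω → ℤ} {s : ℕ → Ω → ∀ j, S j}
  {t : ℕ} {A : Finset ℕ} {c : ℝ}

namespace IsSampledFictitiousPlay

variable [DecidableEq ι] [Fintype (S i)]

theorem signAlgebra_le (h : IsSampledFictitiousPlay P v i ℱ ε s) (t : ℕ) :
    signAlgebra ε t ≤ mΩ :=
  iSup_le fun τ => (h.measurable_sign t τ τ.2).comap_le

variable [IsProbabilityMeasure P]

theorem measure_sign_eq_one_iff (h : IsSampledFictitiousPlay P v i ℱ ε s) {τ : ℕ} (hτ : τ < t)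
    (A : Finset ℕ) : P (ε t τ ⁻¹' {n | n = 1 ↔ τ ∈ A}) = 1 / 2 := by
  by_cases hτA : τ ∈ A
  · simpa only [hτA, iff_true, Set.preimage_ofPred_eq] using (h.sign_law t τ hτ).1
  · have hcompl : ε t τ ⁻¹' {n | n = 1 ↔ τ ∈ A} = {ω | ε t τ ω = 1}ᶜ := by
      ext ω
      simp [hτA]
    rw [hcompl, prob_compl_eq_one_sub
      (measurableSet_eq_fun (h.measurable_sign t τ hτ) measurable_const), (h.sign_law t τ hτ).1]
    simp

theorem measureReal_sampledSet_eq (h : IsSampledFictitiousPlay P v i ℱ ε s)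
    (hA : A ⊆ Finset.range t) :
    P.real {ω | sampledSet t (fun τ => ε t τ ω) = A} = 1 / 2 ^ t := by
  rw [setOf_sampledSet_eq hA, measureReal_def,
    (h.sign_indep t).measure_inter_preimage_eq_mul Finset.univ fun _ _ => .of_discrete,
    Finset.prod_congr rfl fun τ _ => h.measure_sign_eq_one_iff τ.2 A]
  simp

theorem condExp_sampledSet_eq (h : IsSampledFictitiousPlay P v i ℱ ε s)
    (hA : A ⊆ Finset.range t) :
    P⟦{ω | sampledSet t (fun τ => ε t τ ω) = A} | ℱ t⟧ =ᵐ[P] fun _ => 1 / 2 ^ t := by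
  have hmeas := measurableSet_sampledSet_eq (ε := ε) hA
  have hindep := condExp_indep_eq (f := {ω | sampledSet t (fun τ => ε t τ ω) = A}.indicator
    fun _ => (1 : ℝ)) (h.signAlgebra_le t) (ℱ.le t) (stronglyMeasurable_const.indicator hmeas)
    (h.sign_fresh t)
  rwa [integral_indicator_const _ (h.signAlgebra_le t _ hmeas), h.measureReal_sampledSet_eq hA,
    smul_eq_mul, mul_one] at hindep

end IsSampledFictitiousPlay

namespace IsAdaptivePlay

variable [Finite ι] [∀ j, Countable (S j)]

theorem measurable_payoff (hs : IsAdaptivePlay i ℱ s) (φ : (∀ j, S j) → ℝ) (t : ℕ) :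
    Measurable[ℱ (t + 1)] fun ω => φ (s t ω) :=
  measurable_comp_of_countable (hs.past (t + 1) t t.lt_succ_self) φ

theorem measurableSet_own (hs : IsAdaptivePlay i ℱ s) (t : ℕ) (k : S i) :
    MeasurableSet {ω | s t ω i = k} :=
  measurableSet_preimage_of_countable (fun a => ℱ.le _ _ (hs.past (t + 1) t t.lt_succ_self a))
    {a | a i = k}

variable [DecidableEq ι]

theorem measurable_update (hs : IsAdaptivePlay i ℱ s) (φ : (∀ j, S j) → ℝ) {τ : ℕ} (hτ : τ ≤ t)
    (k : S i) : Measurable[ℱ t] fun ω => φ (Function.update (s τ ω) i k) := by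
  refine (measurable_comp_of_countable (fun a => ?_) φ).mono (ℱ.mono hτ) le_rfl
  have hset : {ω | Function.update (s τ ω) i k = a}
      = {_ω | k = a i} ∩ ⋂ j, ⋂ (_ : j ≠ i), {ω | s τ ω j = a j} := by
    ext ω
    simp [Function.update_eq_iff]
  rw [hset]
  exact .inter (.const _) (.iInter fun j => .iInter fun hj => hs.opponents τ j hj (a j))

variable [Fintype (S i)]

theorem measurable_expect_argmaxes_sum (hs : IsAdaptivePlay i ℱ s) (v : (∀ j, S j) → ℝ)
    (hA : A ⊆ Finset.range t) :
    Measurable[ℱ t] fun ω => 𝔼 k ∈ argmaxes (fun k => ∑ τ ∈ A, v (Function.update (s τ ω) i k)),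
      v (Function.update (s t ω) i k) :=
  measurable_expect_argmaxes (fun k => Finset.measurable_fun_sum _ fun _ hτ =>
    hs.measurable_update v (Finset.mem_range.1 (hA hτ)).le k) (hs.measurable_update v le_rfl)

theorem measurable_sampledPayoff (hs : IsAdaptivePlay i ℱ s) (v : (∀ j, S j) → ℝ) (t : ℕ) :
    Measurable[ℱ t] fun ω => sampledPayoff (fun τ k => v (Function.update (s τ ω) i k)) t := by
  simp only [sampledPayoff, Finset.expect_eq_sum_div_card]
  refine (Finset.measurable_fun_sum _ fun A hA => ?_).div_const _
  simpa only [Finset.expect_eq_sum_div_card] using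
    hs.measurable_expect_argmaxes_sum v (Finset.mem_powerset.1 hA)

end IsAdaptivePlay

namespace IsSampledFictitiousPlay

variable [Finite ι] [∀ j, Countable (S j)] [DecidableEq ι] [Fintype (S i)]
  [IsProbabilityMeasure P]

theorem condExp_payoff_sup (hs : IsAdaptivePlay i ℱ s) (h : IsSampledFictitiousPlay P v i ℱ ε s)
    (hv : ∀ a, |v a| ≤ c) (t : ℕ) :
    P[fun ω => v (s t ω) | ℱ t ⊔ signAlgebra ε t] =ᵐ[P] fun ω =>
      𝔼 k ∈ argmaxes (fun k =>
          ∑ τ ∈ sampledSet t fun τ => ε t τ ω, v (Function.update (s τ ω) i k)),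
        v (Function.update (s t ω) i k) := by
  classical
  have hcond := condExp_comp_of_mem_finset (sup_le (ℱ.le t) (h.signAlgebra_le t))
    (X := fun ω => s t ω i) (F := fun k ω => v (Function.update (s t ω) i k))
    (fun _ => Finset.mem_univ _) (fun k _ => hs.measurableSet_own t k)
    (fun k _ => ((hs.measurable_update v (le_refl t) k).stronglyMeasurable.mono le_sup_left))
    (fun _ _ _ => hv _) fun k _ => h.best_response t k
  simp only [Function.update_eq_self] at hcond
  refine hcond.trans (ae_of_all _ fun ω => ?_)
  simp only [Set.indicator_apply, Finset.mem_coe, mul_ite, mul_zero, mul_one_div]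
  rw [Finset.sum_ite_mem, Finset.univ_inter, ← Finset.sum_div, ← Finset.expect_eq_sum_div_card]
  rfl

theorem condExp_payoff [Nonempty (S i)] (hs : IsAdaptivePlay i ℱ s)
    (h : IsSampledFictitiousPlay P v i ℱ ε s) (hv : ∀ a, |v a| ≤ c) (t : ℕ) :
    P[fun ω => v (s t ω) | ℱ t] =ᵐ[P] fun ω =>
      sampledPayoff (fun τ k => v (Function.update (s τ ω) i k)) t := by
  have hsup : ℱ t ⊔ signAlgebra ε t ≤ mΩ := sup_le (ℱ.le t) (h.signAlgebra_le t)
  have hcond := condExp_comp_of_mem_finset (ℱ.le t) (X := fun ω => sampledSet t fun τ => ε t τ ω)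
    (F := fun A ω => 𝔼 k ∈ argmaxes (fun k => ∑ τ ∈ A, v (Function.update (s τ ω) i k)),
      v (Function.update (s t ω) i k)) (fun _ => sampledSet_mem_powerset _ _)
    (fun A hA => h.signAlgebra_le t _ (measurableSet_sampledSet_eq (Finset.mem_powerset.1 hA)))
    (fun A hA => (hs.measurable_expect_argmaxes_sum v
      (Finset.mem_powerset.1 hA)).stronglyMeasurable)
    (fun A _ _ => abs_expect_le_of_forall_abs_le (argmaxes_nonempty _) fun _ _ => hv _)
    fun A hA => h.condExp_sampledSet_eq (Finset.mem_powerset.1 hA)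
  calc _ =ᵐ[P] P[P[fun ω => v (s t ω) | ℱ t ⊔ signAlgebra ε t] | ℱ t] :=
        (condExp_condExp_of_le le_sup_left hsup).symm
    _ =ᵐ[P] _ := (condExp_congr_ae (h.condExp_payoff_sup hs hv t)).trans hcond
    _ =ᵐ[P] _ := ae_of_all _ fun ω => by
        simp [sampledPayoff, Finset.expect_eq_sum_div_card (Finset.powerset _), Finset.sum_mul,
          div_eq_mul_inv]

theorem ae_tendsto_sum_payoff_sub_sampledPayoff_div [Nonempty (S i)] (hs : IsAdaptivePlay i ℱ s)
    (h : IsSampledFictitiousPlay P v i ℱ ε s) (hv : ∀ a, |v a| ≤ c) :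
    ∀ᵐ ω ∂P, Tendsto (fun T : ℕ => (∑ t ∈ Finset.range T,
      (v (s t ω) - sampledPayoff (fun τ k => v (Function.update (s τ ω) i k)) t)) / T)
      atTop (𝓝 0) := by
  set W : ℕ → Ω → ℝ := fun t ω => sampledPayoff (fun τ k => v (Function.update (s τ ω) i k)) t
  have hW (t : ℕ) : StronglyMeasurable[ℱ t] (W t) :=
    (hs.measurable_sampledPayoff v t).stronglyMeasurable
  have hV (t : ℕ) : StronglyMeasurable[ℱ (t + 1)] fun ω => v (s t ω) :=
    (hs.measurable_payoff v t).stronglyMeasurable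
  have hWc (t : ℕ) (ω : Ω) : |W t ω| ≤ c := abs_sampledPayoff_le fun _ => hv _
  have hWint (t : ℕ) : Integrable (W t) P :=
    .of_bound ((hW t).mono (ℱ.le t)).aestronglyMeasurable c (ae_of_all _ (hWc t))
  have hVint (t : ℕ) : Integrable (fun ω => v (s t ω)) P :=
    .of_bound ((hV t).mono (ℱ.le _)).aestronglyMeasurable c (ae_of_all _ fun _ => hv _)
  refine ae_tendsto_sum_range_div_of_abs_le (Y := fun t ω => v (s t ω) - W t ω) (c := c + c)
    (fun t => (hV t).sub ((hW t).mono (ℱ.mono t.le_succ)))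
    (fun t ω => (abs_sub _ _).trans (add_le_add (hv _) (hWc t ω))) fun t => ?_
  calc _ =ᵐ[P] P[fun ω => v (s t ω) | ℱ t] - P[W t | ℱ t] :=
        condExp_sub (hVint t) (hWint t) (ℱ t)
    _ =ᵐ[P] W t - W t := (h.condExp_payoff hs hv t).sub
        (condExp_of_stronglyMeasurable (ℱ.le t) (hW t) (hWint t)).eventuallyEq
    _ = 0 := sub_self _

end IsSampledFictitiousPlay

end Play

section Regret

variable {ι : Type*} [DecidableEq ι] {S : ι → Type*} {i : ι} [Fintype (S i)] [Nonempty (S i)]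
  {v : (∀ j, S j) → ℝ} {s : ℕ → ∀ j, S j} {c : ℝ}

theorem regret_eq_ciSup_sub (T : ℕ) :
    regret v i s T = (⨆ k, ∑ τ ∈ Finset.range T, v (Function.update (s τ) i k))
      - ∑ τ ∈ Finset.range T, v (s τ) := by
  rw [regret, Finset.sup'_univ_eq_ciSup]
  rfl

theorem neg_two_mul_le_regret_div (hv : ∀ a, |v a| ≤ c) (T : ℕ) :
    -(2 * c) ≤ regret v i s T / T := by
  rcases T.eq_zero_or_pos with rfl | hT
  · simpa using (abs_nonneg _).trans (hv (s 0))
  have hsum {a : ℕ → ∀ j, S j} : |∑ τ ∈ Finset.range T, v (a τ)| ≤ T * c := by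
    simpa using (Finset.abs_sum_le_sum_abs _ _).trans
      (Finset.sum_le_card_nsmul (Finset.range T) _ c fun τ _ => hv (a τ))
  obtain ⟨k⟩ := ‹Nonempty (S i)›
  have hsup := Finite.le_ciSup
    (fun k => ∑ τ ∈ Finset.range T, v (Function.update (s τ) i k)) k
  rw [le_div_iff₀ (by positivity), regret_eq_ciSup_sub]
  linarith [neg_le_of_abs_le (hsum (a := fun τ => Function.update (s τ) i k)),
    le_of_abs_le (hsum (a := s))]

theorem limsup_regret_div_le_zero (hv : ∀ a, |v a| ≤ c)
    (h : Tendsto (fun T : ℕ => (∑ t ∈ Finset.range T,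
      (v (s t) - sampledPayoff (fun τ k => v (Function.update (s τ) i k)) t)) / T) atTop (𝓝 0)) :
    limsup (fun T : ℕ => regret v i s T / (T : ℝ)) atTop ≤ 0 := by
  refine le_of_forall_pos_le_add fun δ hδ => limsup_le_of_le
    (isCoboundedUnder_le_of_le atTop (neg_two_mul_le_regret_div hv)) ?_
  filter_upwards [eventually_forall_ciSup_sum_le_sum_sampledPayoff_add (S i) c (half_pos hδ),
    h.eventually_const_lt (neg_lt_zero.2 (half_pos hδ)), eventually_gt_atTop 0] with T hsup hsum hT
  have hmax := hsup (fun τ k => v (Function.update (s τ) i k)) fun _ _ => hv _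
  rw [lt_div_iff₀ (by positivity), Finset.sum_sub_distrib] at hsum
  rw [div_le_iff₀ (by positivity), regret_eq_ciSup_sub]
  linarith

end Regret

end RepeatedGame

theorem theorem1_general {ι : Type*} [Finite ι] [DecidableEq ι] {S : ι → Type*}
    [∀ j, Countable (S j)] (i : ι) [Fintype (S i)] [Nonempty (S i)] (v : (∀ j, S j) → ℝ) {c : ℝ}
    (hv : ∀ a, |v a| ≤ c) {Ω : Type*} {mΩ : MeasurableSpace Ω} (P : Measure Ω)
    [IsProbabilityMeasure P] (ℱ : Filtration ℕ mΩ) (ε : ℕ → ℕ → Ω → ℤ) (s : ℕ → Ω → ∀ j, S j)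
    (hs : RepeatedGame.IsAdaptivePlay i ℱ s)
    (hsfp : RepeatedGame.IsSampledFictitiousPlay P v i ℱ ε s) :
    RepeatedGame.HasNoRegret P v i s :=
  (hsfp.ae_tendsto_sum_payoff_sub_sampledPayoff_div hs hv).mono fun _ h =>
    RepeatedGame.limsup_regret_div_le_zero hv h

theorem theorem1 {ι : Type*} [Fintype ι] [DecidableEq ι] {S : ι → Type*} [∀ j, Fintype (S j)]
    [∀ j, Nonempty (S j)] (u : ι → (∀ j, S j) → ℝ) (i : ι)
    (hu : ∀ a : ∀ j, S j, u i a ∈ Set.Icc (-1 : ℝ) 1)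
    {Ω : Type*} {mΩ : MeasurableSpace Ω} (P : Measure Ω) [IsProbabilityMeasure P]
    (ℱ : Filtration ℕ mΩ) (ε : ℕ → ℕ → Ω → ℤ) (s : ℕ → Ω → ∀ j, S j)
    (hs : RepeatedGame.IsAdaptivePlay i ℱ s)
    (hsfp : RepeatedGame.IsSampledFictitiousPlay P (u i) i ℱ ε s) :
    RepeatedGame.HasNoRegret P (u i) i s :=
  theorem1_general i (u i) (fun a => abs_le.2 (hu a)) P ℱ ε s hs hsfp
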